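/- Throughout, a \emph{normal domain} is a Noetherian integral domain that is integrally closed in its field of fractions. For a normal domain $A$ and an $A$-module $M$ put $M^{*_A}=\operatorname{Hom}_A(M,A)$ and $M^{**_A}=(M^{*_A})^{*_A}$; $M$ is \emph{reflexive} if the natural biduality map $M\to M^{**_A}$ is an isomorphism. The divisor class group $\operatorname{Cl}(A)$ is the abelian group of isomorphism classes $[\mathfrak a]$ of finitely generated reflexive $A$-modules $\mathfrak a$ of rank one, with product $[\mathfrak a]\cdot[\mathfrak b]=[(\mathfrak a\otimes_A\mathfrak b)^{**_A}]$, identity $[A]$ and inverse $[\mathfrak a]^{-1}=[\mathfrak a^{*_A}]$. Let $\operatorname{UFD}(A)$ be the set of $\mathfrak p\in\operatorname{Spec}(A)$ such that $A_{\mathfrak p}$ is a unique factorization domain. We say that a ring homomorphism $\varphi\colon A\to B$ of normal domains satisfies condition $(\dagger)$ if $\varphi^{-1}(P)\in\operatorname{UFD}(A)$ for every prime ideal $P\in\operatorname{Spec}(B)$ of height at most one. In that case there is a well-defined group homomorphism $\operatorname{Cl}(\varphi)\colon\operatorname{Cl}(A)\to\operatorname{Cl}(B)$ given by $[\mathfrak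 a]\mapsto[(\mathfrak a\otimes_AB)^{**_B}]$. \textbf{Theorem.} Let $\varphi\colon A\to B$ and $\psi\colon B\to C$ be ring homomorphisms of normal domains such that each of $\varphi$, $\psi$ and $\psi\circ\varphi$ satisfies $(\dagger)$. Then the induced group homomorphisms $\operatorname{Cl}(\varphi)$, $\operatorname{Cl}(\psi)$ and $\operatorname{Cl}(\psi\circ\varphi)$ exist and $$\operatorname{Cl}(\psi\circ\varphi)=\operatorname{Cl}(\psi)\circ\operatorname{Cl}(\varphi)\colon\operatorname{Cl}(A)\to\operatorname{Cl}(C).$$ -/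

import Mathlib

open Module TensorProduct
open scoped nonZeroDivisors

universe u

/-- A finitely generated reflexive `A`-module of rank one: the biduality map `M → M**` is bijective
and `K ⊗ M` is one-dimensional over the field of fractions `K` of `A`. -/
class IsRankOneReflexive (A : Type u) [CommRing A] [IsDomain A]
    (M : Type u) [AddCommGroup M] [Module A M] : Prop where
  finite : Module.Finite A M
  reflexive : Module.IsReflexive A M
  rank_one : Module.finrank (FractionRing A) (FractionRing A ⊗[A] M) = 1

/-- The double dual `M** = Hom_A(Hom_A(M, A), A)`. -/
abbrev DoubleDual (A : Type u) [CommRing A] (M : Type u) [AddCommGroup M] [Module A M] : Type u :=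
  Dual A (Dual A M)

namespace DivisorClass

section Rank

variable {A : Type u} [CommRing A] [IsDomain A]
  {M N : Type u} [AddCommGroup M] [Module A M] [AddCommGroup N] [Module A N]

/-- Auxiliary elementary description of rank one: an element `e` and a functional `g` with
`g e ≠ 0` such that `(g e) m = (g m) e` modulo torsion for all `m`. -/
def GenericGenerator (A : Type u) [CommRing A]
    (M : Type u) [AddCommGroup M] [Module A M] : Prop :=
  ∃ (e : M) (g : Dual A M), g e ≠ 0 ∧ ∀ m : M, ∃ t : A, t ≠ 0 ∧ t • (g e • m - g m • e) = 0

theorem GenericGenerator.finrank_eq_one (h : GenericGenerator A M) :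
    Module.finrank (FractionRing A) (FractionRing A ⊗[A] M) = 1 := by
  obtain ⟨e, g, hge, hm⟩ := h
  have hne : (1 : FractionRing A) ⊗ₜ[A] e ≠ 0 := by
    intro h0
    have h1 := congrArg (TensorProduct.rid A (FractionRing A) ∘ (g.lTensor (FractionRing A))) h0
    simp only [Function.comp_apply, LinearMap.lTensor_tmul, TensorProduct.rid_tmul, map_zero] at h1
    rw [Algebra.smul_def, mul_one] at h1
    exact hge ((FaithfulSMul.algebraMap_eq_zero_iff A (FractionRing A)).1 h1)
  rw [finrank_eq_one_iff_of_nonzero' _ hne]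
  have hgK : algebraMap A (FractionRing A) (g e) ≠ 0 := fun h0 =>
    hge ((FaithfulSMul.algebraMap_eq_zero_iff A (FractionRing A)).1 h0)
  intro w
  induction w using TensorProduct.induction_on with
  | zero => exact ⟨0, zero_smul _ _⟩
  | add x y hx hy =>
    obtain ⟨a, rfl⟩ := hx
    obtain ⟨b, rfl⟩ := hy
    exact ⟨a + b, add_smul _ _ _⟩
  | tmul k m =>
    obtain ⟨t, ht, h0⟩ := hm m
    have htK : algebraMap A (FractionRing A) t ≠ 0 := fun h0 =>
      ht ((FaithfulSMul.algebraMap_eq_zero_iff A (FractionRing A)).1 h0)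
    refine ⟨k * algebraMap A (FractionRing A) (g m) / algebraMap A (FractionRing A) (g e), ?_⟩
    have h1 : t • (g e • m) = t • (g m • e) := by
      rw [smul_sub, sub_eq_zero] at h0
      exact h0
    rw [TensorProduct.smul_tmul', smul_eq_mul, mul_one]
    calc (k * algebraMap A (FractionRing A) (g m) / algebraMap A (FractionRing A) (g e)) ⊗ₜ[A] e
        = ((t * g m) • (k / (algebraMap A (FractionRing A) t * algebraMap A (FractionRing A) (g e))))
            ⊗ₜ[A] e := by
          congr 1
          rw [Algebra.smul_def, map_mul]
          field_simp
      _ = (k / (algebraMap A (FractionRing A) t * algebraMap A (FractionRing A) (g e)))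
            ⊗ₜ[A] (t • (g e • m)) := by
          rw [TensorProduct.smul_tmul, h1, mul_smul]
      _ = k ⊗ₜ[A] m := by
          rw [← mul_smul, ← TensorProduct.smul_tmul]
          congr 1
          rw [Algebra.smul_def, map_mul]
          field_simp

theorem GenericGenerator.of_finrank [Module.Finite A M]
    (h : Module.finrank (FractionRing A) (FractionRing A ⊗[A] M) = 1) : GenericGenerator A M := by
  let K := FractionRing A
  let ℓ : K ⊗[A] M ≃ₗ[K] K := LinearEquiv.ofFinrankEq _ _ (by rw [h, finrank_self])
  let l : M →ₗ[A] K := (ℓ.toLinearMap.restrictScalars A) ∘ₗ TensorProduct.mk A K M 1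
  obtain ⟨s, hs⟩ := (Module.Finite.fg_top : (⊤ : Submodule A M).FG)
  classical
  obtain ⟨d, hd⟩ := IsLocalization.exist_integer_multiples_of_finset A⁰ (s.image l)
  have hint : ∀ m : M, (d : A) • l m ∈ LinearMap.range (Algebra.linearMap A K) := by
    intro m
    have hmem : m ∈ Submodule.span A (s : Set M) := hs ▸ Submodule.mem_top
    induction hmem using Submodule.span_induction with
    | mem x hx =>
      obtain ⟨a, ha⟩ := hd (l x) (Finset.mem_image_of_mem l hx)
      exact ⟨a, ha⟩
    | zero => simp
    | add x y _ _ hx hy => rw [map_add, smul_add]; exact Submodule.add_mem _ hx hy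
    | smul a x _ hx => rw [map_smul, smul_comm]; exact Submodule.smul_mem _ a hx
  have hinj : Function.Injective (Algebra.linearMap A K) := FaithfulSMul.algebraMap_injective A K
  let E := LinearEquiv.ofInjective (Algebra.linearMap A K) hinj
  let g : M →ₗ[A] A := E.symm.toLinearMap ∘ₗ (((d : A) • l).codRestrict _ hint)
  have hg : ∀ m, algebraMap A K (g m) = (d : A) • l m := fun m =>
    congrArg Subtype.val (E.apply_symm_apply (((d : A) • l).codRestrict _ hint m))
  have hdK : algebraMap A K d ≠ 0 := fun h0 =>
    nonZeroDivisors.coe_ne_zero d ((FaithfulSMul.algebraMap_eq_zero_iff A K).1 h0)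
  have hex : ∃ e, g e ≠ 0 := by
    by_contra hcon
    push Not at hcon
    have hl : ∀ m, l m = 0 := fun m => by
      have h1 := hg m
      rw [hcon m, map_zero, Algebra.smul_def] at h1
      exact (mul_eq_zero.1 h1.symm).resolve_left hdK
    have hz : ∀ w : K ⊗[A] M, ℓ w = 0 := by
      intro w
      induction w using TensorProduct.induction_on with
      | zero => exact map_zero _
      | add x y hx hy => rw [map_add, hx, hy, add_zero]
      | tmul k m =>
        have : k ⊗ₜ[A] m = k • ((1 : K) ⊗ₜ[A] m) := by
          rw [TensorProduct.smul_tmul', smul_eq_mul, mul_one]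
        rw [this, map_smul]
        have h2 : ℓ ((1 : K) ⊗ₜ[A] m) = 0 := hl m
        rw [h2, smul_zero]
    exact one_ne_zero ((ℓ.apply_symm_apply (1 : K)).symm.trans (hz _))
  obtain ⟨e, he⟩ := hex
  refine ⟨e, g, he, fun m => ?_⟩
  have h0 : TensorProduct.mk A K M 1 (g e • m - g m • e) = 0 := by
    apply ℓ.injective
    have h1 : l (g e • m - g m • e) = 0 := by
      rw [map_sub, map_smul, map_smul, Algebra.smul_def, Algebra.smul_def, hg, hg,
        Algebra.smul_def, Algebra.smul_def]
      ring
    exact h1.trans (map_zero ℓ).symm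
  obtain ⟨t, ht⟩ := (IsLocalizedModule.eq_zero_iff A⁰ (TensorProduct.mk A K M 1)).1 h0
  exact ⟨t, nonZeroDivisors.coe_ne_zero t, ht⟩

/-- For a module with a generic generator, `(g e) h(m) = h(e) g(m)` for every functional `h`. -/
theorem GenericGenerator.exists_functional (h : GenericGenerator A M) :
    ∃ (e : M) (g : Dual A M), g e ≠ 0 ∧ ∀ k : Dual A M, g e • k = k e • g := by
  obtain ⟨e, g, hge, hm⟩ := h
  refine ⟨e, g, hge, fun k => LinearMap.ext fun m => ?_⟩
  obtain ⟨t, ht, h0⟩ := hm m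
  have h1 := congrArg k h0
  rw [map_smul, map_sub, map_smul, map_smul, map_zero, smul_eq_mul] at h1
  have h2 := (mul_eq_zero.1 h1).resolve_left ht
  simp only [smul_eq_mul, LinearMap.smul_apply] at h2 ⊢
  linear_combination h2

theorem GenericGenerator.dual (h : GenericGenerator A M) : GenericGenerator A (Dual A M) := by
  obtain ⟨e, g, hge, hk⟩ := h.exists_functional
  refine ⟨g, Dual.eval A M e, hge, fun k => ⟨1, one_ne_zero, ?_⟩⟩
  simp only [Dual.eval_apply, hk k, sub_self, smul_zero]

theorem GenericGenerator.tensor (hM : GenericGenerator A M) (hN : GenericGenerator A N) :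
    GenericGenerator A (M ⊗[A] N) := by
  obtain ⟨e, g, hge, hm⟩ := hM
  obtain ⟨e', g', hge', hn⟩ := hN
  let G : Dual A (M ⊗[A] N) := TensorProduct.dualDistrib A M N (g ⊗ₜ g')
  refine ⟨e ⊗ₜ e', G, ?_, fun w => ?_⟩
  · simpa [G] using ⟨hge, hge'⟩
  induction w using TensorProduct.induction_on with
  | zero => exact ⟨1, one_ne_zero, by simp⟩
  | add x y hx hy =>
    obtain ⟨s, hs, hs0⟩ := hx
    obtain ⟨t, ht, ht0⟩ := hy
    refine ⟨s * t, mul_ne_zero hs ht, ?_⟩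
    have : G (e ⊗ₜ e') • (x + y) - G (x + y) • (e ⊗ₜ[A] e') =
        (G (e ⊗ₜ e') • x - G x • (e ⊗ₜ[A] e')) + (G (e ⊗ₜ e') • y - G y • (e ⊗ₜ[A] e')) := by
      rw [map_add, smul_add, add_smul]; abel
    rw [this, smul_add, mul_comm s t, mul_smul, hs0, mul_comm t s, mul_smul, ht0]
    simp
  | tmul m n =>
    obtain ⟨s, hs, hs0⟩ := hm m
    obtain ⟨t, ht, ht0⟩ := hn n
    refine ⟨s * t, mul_ne_zero hs ht, ?_⟩
    rw [smul_sub, sub_eq_zero] at hs0 ht0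
    have h1 : (s • g e • m) ⊗ₜ[A] (t • g' e' • n) = (s • g m • e) ⊗ₜ[A] (t • g' n • e') := by
      rw [hs0, ht0]
    simp only [TensorProduct.smul_tmul_smul] at h1
    simp only [G, TensorProduct.dualDistrib_apply]
    rw [smul_sub, sub_eq_zero]
    exact h1

theorem GenericGenerator.self : GenericGenerator A A :=
  ⟨1, LinearMap.id, one_ne_zero, fun m => ⟨1, one_ne_zero, by simp⟩⟩

/-- The dual of a module of rank one is reflexive. -/
theorem GenericGenerator.isReflexive_dual (h : GenericGenerator A M) :
    Module.IsReflexive A (Dual A M) := by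
  obtain ⟨e, g, hge, hk⟩ := h.exists_functional
  have hx : ∀ x : DoubleDual A M, g e • x = x g • Dual.eval A M e := by
    intro x
    refine LinearMap.ext fun k => ?_
    have h1 := congrArg x (hk k)
    rw [map_smul, map_smul] at h1
    simp only [LinearMap.smul_apply, Dual.eval_apply, smul_eq_mul] at h1 ⊢
    linear_combination h1
  refine ⟨⟨fun k k' hkk => LinearMap.ext fun m => ?_, fun F => ?_⟩⟩
  · exact congrArg (fun G : Dual A (DoubleDual A M) => G (Dual.eval A M m)) hkk
  · refine ⟨F ∘ₗ Dual.eval A M, LinearMap.ext fun x => ?_⟩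
    apply mul_left_cancel₀ hge
    have h1 := congrArg F (hx x)
    rw [map_smul, map_smul] at h1
    have h2 := congrArg (fun y : DoubleDual A M => y (F ∘ₗ Dual.eval A M)) (hx x)
    simp only [LinearMap.smul_apply, Dual.eval_apply, smul_eq_mul, LinearMap.comp_apply] at h1 h2 ⊢
    rw [h1, h2]

end Rank

section Instances

variable {A : Type u} [CommRing A] [IsDomain A]
  {M N P : Type u} [AddCommGroup M] [Module A M] [AddCommGroup N] [Module A N]
  [AddCommGroup P] [Module A P]

theorem genericGenerator_of_isRankOneReflexive (h : IsRankOneReflexive A M) :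
    GenericGenerator A M :=
  haveI := h.finite
  .of_finrank h.rank_one

theorem isRankOneReflexive_dual [IsNoetherianRing A] [Module.Finite A M]
    (h : GenericGenerator A M) : IsRankOneReflexive A (Dual A M) where
  finite := inferInstance
  reflexive := h.isReflexive_dual
  rank_one := h.dual.finrank_eq_one

instance isRankOneReflexive_self : IsRankOneReflexive A A where
  finite := inferInstance
  reflexive := inferInstance
  rank_one := GenericGenerator.self.finrank_eq_one

instance isRankOneReflexive_dual_inst [IsNoetherianRing A] [h : IsRankOneReflexive A M] :
    IsRankOneReflexive A (Dual A M) :=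
  haveI := h.finite
  isRankOneReflexive_dual (genericGenerator_of_isRankOneReflexive h)

instance isRankOneReflexive_tensor [IsNoetherianRing A]
    [hM : IsRankOneReflexive A M] [hN : IsRankOneReflexive A N] :
    IsRankOneReflexive A (DoubleDual A (M ⊗[A] N)) :=
  haveI := hM.finite
  haveI := hN.finite
  isRankOneReflexive_dual ((genericGenerator_of_isRankOneReflexive hM).tensor
    (genericGenerator_of_isRankOneReflexive hN)).dual

/-- `(M** ⊗ N)* ≅ (M ⊗ N)*` for `M` of rank one. -/
theorem dual_tensor_doubleDual (hM : GenericGenerator A M) :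
    Nonempty (Dual A (DoubleDual A M ⊗[A] N) ≃ₗ[A] Dual A (M ⊗[A] N)) :=
  haveI := hM.isReflexive_dual
  ⟨(TensorProduct.comm A N (DoubleDual A M)).dualMap ≪≫ₗ
    (TensorProduct.lift.equiv (.id A) N (DoubleDual A M) A).symm ≪≫ₗ
    LinearEquiv.congrRight (Module.evalEquiv A (Dual A M)).symm ≪≫ₗ
    TensorProduct.lift.equiv (.id A) N M A ≪≫ₗ
    (TensorProduct.comm A M N).dualMap⟩

theorem doubleDual_congr (e : M ≃ₗ[A] N) : Nonempty (DoubleDual A M ≃ₗ[A] DoubleDual A N) :=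
  ⟨e.dualMap.dualMap⟩

/-- `(M** ⊗ N)** ≅ (M ⊗ N)**` for `M` of rank one. -/
theorem doubleDual_tensor_doubleDual (hM : GenericGenerator A M) :
    Nonempty (DoubleDual A (DoubleDual A M ⊗[A] N) ≃ₗ[A] DoubleDual A (M ⊗[A] N)) :=
  (dual_tensor_doubleDual hM).map fun e => e.symm.dualMap

/-- Over a normal domain every endomorphism of a dual of rank one is a homothety. -/
theorem algebraMap_end_bijective [IsNoetherianRing A] [IsIntegrallyClosed A] [Module.Finite A M]
    (hM : GenericGenerator A M) :
    Function.Bijective (Algebra.linearMap A (Module.End A (Dual A M))) := by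
  obtain ⟨e, g, hge, hk⟩ := hM.exists_functional
  constructor
  · intro a b hab
    have h1 := congrArg (fun F : Module.End A (Dual A M) => F g e) hab
    simp only [Algebra.linearMap_apply, Module.algebraMap_end_apply, LinearMap.smul_apply,
      smul_eq_mul] at h1
    exact mul_right_cancel₀ hge h1
  · intro F
    -- `F k` is determined by its value at `e`: `(g e) (F k)(e) = k(e) (F g)(e)`
    have key : ∀ k, g e * F k e = k e * F g e := by
      intro k
      have h1 := congrArg (fun k' => F k' e) (hk k)
      simpa using h1
    let K := FractionRing A
    have hgK : algebraMap A K (g e) ≠ 0 := fun h0 =>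
      hge ((FaithfulSMul.algebraMap_eq_zero_iff A K).1 h0)
    let c : K := algebraMap A K (F g e) / algebraMap A K (g e)
    have hFc : ∀ k, algebraMap A K (F k e) = c * algebraMap A K (k e) := by
      intro k
      have h1 := congrArg (algebraMap A K) (key k)
      rw [map_mul, map_mul] at h1
      rw [div_mul_eq_mul_div, eq_div_iff hgK]
      linear_combination h1
    have hpow : ∀ n : ℕ, algebraMap A K ((F ^ n) g e) = c ^ n * algebraMap A K (g e) := by
      intro n
      induction n with
      | zero => simp
      | succ n ih =>
        rw [pow_succ', Module.End.mul_apply, hFc, ih, pow_succ']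
        ring
    have hF : IsIntegral A F := Algebra.IsIntegral.isIntegral F
    obtain ⟨p, hp, hp0⟩ := hF
    have hc : IsIntegral A c := by
      refine ⟨p, hp, ?_⟩
      rw [← Polynomial.aeval_def] at hp0 ⊢
      have h1 := congrArg (fun G : Module.End A (Dual A M) => algebraMap A K (G g e)) hp0
      rw [Polynomial.aeval_eq_sum_range] at h1 ⊢
      simp only [LinearMap.coe_sum, Finset.sum_apply, LinearMap.smul_apply, map_sum, smul_eq_mul,
        map_mul, hpow, LinearMap.zero_apply, map_zero] at h1
      have h2 : (∑ i ∈ Finset.range (p.natDegree + 1), p.coeff i • c ^ i) * algebraMap A K (g e)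
          = 0 := by
        rw [Finset.sum_mul, ← h1]
        exact Finset.sum_congr rfl fun i _ => by rw [Algebra.smul_def]; ring
      exact (mul_eq_zero.1 h2).resolve_right hgK
    obtain ⟨a, ha⟩ := IsIntegrallyClosed.isIntegral_iff.1 hc
    refine ⟨a, LinearMap.ext fun k => ?_⟩
    have h1 : F k e = a * k e := by
      apply FaithfulSMul.algebraMap_injective A K
      rw [hFc, map_mul, ha]
    have h2 : g e • F k = g e • (a • k) := by
      rw [hk (F k), h1, smul_comm, hk k, mul_smul]
    rw [Algebra.linearMap_apply, Module.algebraMap_end_apply]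
    refine LinearMap.ext fun m => mul_left_cancel₀ hge ?_
    exact (congrArg (fun k' : Dual A M => k' m) h2).symm

/-- `(M* ⊗ M)** ≅ A` for `M` of rank one over a normal domain. -/
theorem doubleDual_dual_tensor [IsNoetherianRing A] [IsIntegrallyClosed A] [Module.Finite A M]
    (hM : GenericGenerator A M) :
    Nonempty (DoubleDual A (Dual A M ⊗[A] M) ≃ₗ[A] A) :=
  let e : Dual A (Dual A M ⊗[A] M) ≃ₗ[A] A :=
    (TensorProduct.lift.equiv (.id A) (Dual A M) M A).symm ≪≫ₗ
      (LinearEquiv.ofBijective _ (algebraMap_end_bijective hM)).symm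
  ⟨e.symm.dualMap ≪≫ₗ LinearMap.ringLmapEquivSelf A A A⟩

end Instances

end DivisorClass

/-- A bundled finitely generated reflexive `A`-module of rank one. -/
structure RankOneReflexive (A : Type u) [CommRing A] [IsDomain A] where
  carrier : Type u
  [addCommGroup : AddCommGroup carrier]
  [module : Module A carrier]
  [isRankOneReflexive : IsRankOneReflexive A carrier]

attribute [instance] RankOneReflexive.addCommGroup RankOneReflexive.module
  RankOneReflexive.isRankOneReflexive

/-- Two rank-one reflexive modules are equivalent if they are isomorphic. -/
instance RankOneReflexive.setoid (A : Type u) [CommRing A] [IsDomain A] :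
    Setoid (RankOneReflexive A) where
  r M N := Nonempty (M.carrier ≃ₗ[A] N.carrier)
  iseqv := ⟨fun _ => ⟨.refl _ _⟩, fun ⟨e⟩ => ⟨e.symm⟩, fun ⟨e⟩ ⟨f⟩ => ⟨e ≪≫ₗ f⟩⟩

/-- The divisor class group `Cl(A)`: isomorphism classes of finitely generated reflexive
`A`-modules of rank one. -/
def DivisorClassGroup (A : Type u) [CommRing A] [IsDomain A] : Type (u + 1) :=
  Quotient (RankOneReflexive.setoid A)

namespace DivisorClassGroup

/-- The divisor class `[M]` of a rank-one reflexive module. -/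
def cl (A : Type u) [CommRing A] [IsDomain A]
    (M : Type u) [AddCommGroup M] [Module A M] [IsRankOneReflexive A M] : DivisorClassGroup A :=
  Quotient.mk _ ⟨M⟩

section Group

variable {A : Type u} [CommRing A] [IsDomain A]

theorem cl_eq_cl {M N : Type u} [AddCommGroup M] [Module A M] [IsRankOneReflexive A M]
    [AddCommGroup N] [Module A N] [IsRankOneReflexive A N] :
    cl A M = cl A N ↔ Nonempty (M ≃ₗ[A] N) :=
  Quotient.eq

theorem ind {p : DivisorClassGroup A → Prop}
    (h : ∀ (M : Type u) [AddCommGroup M] [Module A M] [IsRankOneReflexive A M], p (cl A M))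
    (x : DivisorClassGroup A) : p x :=
  Quotient.inductionOn x fun M => h M.carrier

/-- The identity is `[A]`. -/
instance : One (DivisorClassGroup A) := ⟨cl A A⟩

/-- Multiplication is `[M] * [N] = [(M ⊗ N)**]`. -/
instance [IsNoetherianRing A] : Mul (DivisorClassGroup A) :=
  ⟨Quotient.map₂ (fun M N => ⟨DoubleDual A (M.carrier ⊗[A] N.carrier)⟩)
    fun _ _ ⟨e⟩ _ _ ⟨f⟩ => DivisorClass.doubleDual_congr (TensorProduct.congr e f)⟩

/-- The inverse is `[M]⁻¹ = [M*]`. -/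
instance [IsNoetherianRing A] : Inv (DivisorClassGroup A) :=
  ⟨Quotient.map (fun M => ⟨Dual A M.carrier⟩) fun _ _ ⟨e⟩ => ⟨e.symm.dualMap⟩⟩

theorem one_def : (1 : DivisorClassGroup A) = cl A A := rfl

theorem cl_mul_cl [IsNoetherianRing A] (M N : Type u)
    [AddCommGroup M] [Module A M] [IsRankOneReflexive A M]
    [AddCommGroup N] [Module A N] [IsRankOneReflexive A N] :
    cl A M * cl A N = cl A (DoubleDual A (M ⊗[A] N)) := rfl

theorem inv_cl [IsNoetherianRing A] (M : Type u)
    [AddCommGroup M] [Module A M] [IsRankOneReflexive A M] :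
    (cl A M)⁻¹ = cl A (Dual A M) := rfl

protected theorem mul_comm' [IsNoetherianRing A] (x y : DivisorClassGroup A) :
    x * y = y * x := by
  induction x using ind with | _ M
  induction y using ind with | _ N
  rw [cl_mul_cl, cl_mul_cl, cl_eq_cl]
  exact DivisorClass.doubleDual_congr (TensorProduct.comm A M N)

protected theorem mul_assoc' [IsNoetherianRing A] (x y z : DivisorClassGroup A) :
    x * y * z = x * (y * z) := by
  rw [DivisorClassGroup.mul_comm' x (y * z)]
  induction x using ind with | _ M
  have hM : IsRankOneReflexive A M := inferInstance
  induction y using ind with | _ N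
  have hN : IsRankOneReflexive A N := inferInstance
  induction z using ind with | _ P
  have hP : IsRankOneReflexive A P := inferInstance
  simp only [cl_mul_cl, cl_eq_cl]
  have gM := DivisorClass.genericGenerator_of_isRankOneReflexive hM
  have gN := DivisorClass.genericGenerator_of_isRankOneReflexive hN
  have gP := DivisorClass.genericGenerator_of_isRankOneReflexive hP
  obtain ⟨e⟩ := DivisorClass.doubleDual_tensor_doubleDual (N := P) (gM.tensor gN)
  obtain ⟨f⟩ := DivisorClass.doubleDual_congr
    (TensorProduct.assoc A M N P ≪≫ₗ TensorProduct.comm A M (N ⊗[A] P))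
  obtain ⟨g⟩ := DivisorClass.doubleDual_tensor_doubleDual (N := M) (gN.tensor gP)
  exact ⟨e ≪≫ₗ f ≪≫ₗ g.symm⟩

protected theorem one_mul' [IsNoetherianRing A] (x : DivisorClassGroup A) : 1 * x = x := by
  induction x using ind with | _ M
  have hM : IsRankOneReflexive A M := inferInstance
  rw [one_def, cl_mul_cl, cl_eq_cl]
  have := hM.reflexive
  obtain ⟨e⟩ := DivisorClass.doubleDual_congr (TensorProduct.lid A M)
  exact ⟨e ≪≫ₗ (Module.evalEquiv A M).symm⟩

protected theorem inv_mul_cancel' [IsNoetherianRing A] [IsIntegrallyClosed A]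
    (x : DivisorClassGroup A) : x⁻¹ * x = 1 := by
  induction x using ind with | _ M
  have hM : IsRankOneReflexive A M := inferInstance
  rw [one_def, inv_cl, cl_mul_cl, cl_eq_cl]
  have := hM.finite
  exact DivisorClass.doubleDual_dual_tensor
    (DivisorClass.genericGenerator_of_isRankOneReflexive hM)

/-- The group structure on `Cl(A)` for a (Noetherian) normal domain `A`. -/
instance [IsNoetherianRing A] [IsIntegrallyClosed A] : CommGroup (DivisorClassGroup A) where
  mul_assoc := DivisorClassGroup.mul_assoc'
  one_mul := DivisorClassGroup.one_mul'
  mul_one x := (DivisorClassGroup.mul_comm' x 1).trans (DivisorClassGroup.one_mul' x)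
  inv_mul_cancel := DivisorClassGroup.inv_mul_cancel'
  mul_comm := DivisorClassGroup.mul_comm'

end Group

end DivisorClassGroup

/-- The set `UFD(A)` of primes `𝔭` of `A` such that `A_𝔭` is a unique factorization domain. -/
def UFDLocus (A : Type u) [CommRing A] [IsDomain A] : Set (PrimeSpectrum A) :=
  {p | UniqueFactorizationMonoid (Localization.AtPrime p.asIdeal)}

/-- Every prime of `B` of height at most one contracts to a prime in `UFD(A)`. -/
def ContractsToUFDLocus {A B : Type u} [CommRing A] [IsDomain A] [CommRing B]
    (φ : A →+* B) : Prop :=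
  ∀ P : PrimeSpectrum B, P.asIdeal.height ≤ 1 → PrimeSpectrum.comap φ P ∈ UFDLocus A

/-- The group homomorphism `f : Cl(A) → Cl(B)` is the map `Cl(φ)` induced by `φ : A → B`: for every
rank-one reflexive `A`-module `M`, the `B`-module `(M ⊗_A B)**` is rank-one reflexive
and `f [M] = [(M ⊗_A B)**]`. -/
def IsInducedClassMap {A B : Type u} [CommRing A] [IsDomain A] [IsNoetherianRing A]
    [IsIntegrallyClosed A] [CommRing B] [IsDomain B] [IsNoetherianRing B] [IsIntegrallyClosed B]
    (φ : A →+* B) (f : DivisorClassGroup A →* DivisorClassGroup B) : Prop :=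
  letI : Algebra A B := φ.toAlgebra
  ∀ (M : Type u) [AddCommGroup M] [Module A M] [IsRankOneReflexive A M],
    ∃ _ : IsRankOneReflexive B (DoubleDual B (B ⊗[A] M)),
      f (DivisorClassGroup.cl A M) = DivisorClassGroup.cl B (DoubleDual B (B ⊗[A] M))

/-- The defining formula determines the induced map uniquely. -/
theorem IsInducedClassMap.unique {A B : Type u} [CommRing A] [IsDomain A] [IsNoetherianRing A]
    [IsIntegrallyClosed A] [CommRing B] [IsDomain B] [IsNoetherianRing B] [IsIntegrallyClosed B]
    {φ : A →+* B} {f g : DivisorClassGroup A →* DivisorClassGroup B}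
    (hf : IsInducedClassMap φ f) (hg : IsInducedClassMap φ g) : f = g := by
  ext x
  induction x using DivisorClassGroup.ind with | _ M
  obtain ⟨_, h₁⟩ := hf M
  obtain ⟨_, h₂⟩ := hg M
  exact h₁.trans h₂.symm

/-! Both sides send `[M]` to the double dual of an iterated base change, since `C ⊗ (B ⊗ M) ≅ C ⊗
M`. What must be shown is that the inner double dual `(B ⊗ M)**` may be replaced by `B ⊗ M` before
tensoring with `C` and reflexivizing.

For a module `N` over `B`, the map `C ⊗ N → C ⊗ N**` is harmless as soon as `N` is free of rank one
at the contractions of all primes of `C` of height at most one (`doubleDual_baseChange_doubleDual`):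
its kernel is then torsion and it is surjective at those primes, and over a normal domain such a map
has bijective dual (`dualMap_bijective`), because divisibility is detected in height at most one.

For `N = B ⊗ M` this freeness is inherited from `M`: by (†) for the composite, the primes in
question contract to `UFD(A)`, where rank-one reflexive modules are free
(`localGenerator_of_mem_UFDLocus`). The same lemma applied to `M ⊗ N` shows that each `Cl` map is
multiplicative. -/

namespace DivisorClass

/-! ### Divisibility and duals in height at most one -/

section Normal

variable {B : Type u} [CommRing B] [IsDomain B] [IsNoetherianRing B] [IsIntegrallyClosed B]

/-- In a normal domain, a prime of the form `(b : c)` with `b ≠ 0` has height at most one. -/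
theorem height_le_one_of_mem_iff_dvd_mul {b c : B} (hb : b ≠ 0) {P : Ideal B} [hP : P.IsPrime]
    (h : ∀ r, r ∈ P ↔ b ∣ r * c) : P.height ≤ 1 := by
  have hc : ¬ b ∣ c := fun hbc => hP.ne_top ((Ideal.eq_top_iff_one P).2 ((h 1).2 (by simpa)))
  have hbP : b ∈ P := (h b).2 (dvd_mul_right _ _)
  obtain ⟨y, hy, u, hu, hyu⟩ : ∃ y ∈ P, ∃ u ∉ P, y * c = b * u := by
    -- Otherwise `c / b` maps the finitely generated nonzero ideal `P` into itself, so it is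
    -- integral and lies in `B`, against `b ∤ c`.
    by_contra! hcon
    let K := FractionRing B
    have hbK : algebraMap B K b ≠ 0 := IsFractionRing.to_map_eq_zero_iff.not.mpr hb
    let N : Submodule B K := Submodule.map (Algebra.linearMap B K) P
    have hx : ∀ y ∈ N, (algebraMap B K c / algebraMap B K b) • y ∈ N := by
      rintro _ ⟨y, hy, rfl⟩
      obtain ⟨u, hu⟩ := (h y).1 hy
      refine ⟨u, by_contra fun hu' => hcon y hy u hu' hu, ?_⟩
      rw [Algebra.linearMap_apply, Algebra.linearMap_apply, smul_eq_mul, div_mul_eq_mul_div,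
        eq_div_iff hbK, ← map_mul, ← map_mul, mul_comm u, ← hu, mul_comm]
    have hint := isIntegral_of_smul_mem_submodule N
      ((Submodule.ne_bot_iff _).2 ⟨_, ⟨b, hbP, rfl⟩, hbK⟩)
      (Submodule.FG.map _ (IsNoetherian.noetherian P)) _ hx
    obtain ⟨z, hz⟩ := IsIntegrallyClosed.algebraMap_eq_of_integral hint
    refine hc ⟨z, IsFractionRing.injective B K ?_⟩
    rw [map_mul, hz, mul_div_cancel₀ _ hbK]
  -- Krull's principal ideal theorem: `P` is minimal over `(y)`, because `u ∉ P` multiplies all of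
  -- `P` into `(y)`.
  refine Ideal.height_le_one_of_isPrincipal_of_mem_minimalPrimes (Ideal.span {y}) P
    ⟨⟨hP, (Ideal.span_singleton_le_iff_mem _).2 hy⟩, fun Q hQ hQP z hz => ?_⟩
  obtain ⟨w, hw⟩ := (h z).1 hz
  have h1 : z * u = w * y := mul_left_cancel₀ hb (by linear_combination y * hw - z * hyu)
  have h2 : z * u ∈ Q := h1 ▸ Q.mul_mem_left w ((Ideal.span_singleton_le_iff_mem _).1 hQ.2)
  exact (hQ.1.mem_or_mem h2).resolve_right fun h3 => hu (hQP h3)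

/-- Divisibility in a normal domain can be checked at the primes of height at most one. -/
theorem dvd_of_forall_height_le_one {a b : B} (hb : b ≠ 0)
    (h : ∀ P : PrimeSpectrum B, P.asIdeal.height ≤ 1 → ∃ t ∉ P.asIdeal, b ∣ t * a) : b ∣ a := by
  by_contra hba
  have hx : Ideal.Quotient.mk (Ideal.span {b}) a ≠ 0 := by
    rwa [Ne, Ideal.Quotient.eq_zero_iff_mem, Ideal.mem_span_singleton]
  have hcolon : ∀ r c : B, r ∈ (⊥ : Submodule B (B ⧸ Ideal.span {b})).colon
      {Ideal.Quotient.mk (Ideal.span {b}) c} ↔ b ∣ r * c := by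
    intro r c
    rw [Submodule.mem_colon_singleton, Submodule.mem_bot, Algebra.smul_def,
      Ideal.Quotient.algebraMap_eq, ← map_mul, Ideal.Quotient.eq_zero_iff_mem,
      Ideal.mem_span_singleton]
  -- The annihilator of the class of `a` lies in an associated prime of `B / (b)`; this has the form
  -- `(b : c)`, hence height at most one.
  obtain ⟨P, hP, hle⟩ := exists_le_isAssociatedPrime_of_isNoetherianRing B _ hx
  obtain ⟨hPp, x, hPx⟩ := isAssociatedPrime_iff.1 hP
  obtain ⟨c, rfl⟩ := Ideal.Quotient.mk_surjective x
  obtain ⟨t, ht, htd⟩ := h ⟨P, hPp⟩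
    (height_le_one_of_mem_iff_dvd_mul hb fun r => (SetLike.ext_iff.1 hPx r).trans (hcolon r c))
  exact ht (hle ((hcolon t a).2 htd))

/-- A linear map with torsion kernel which is surjective at every prime of height at most one
has bijective dual. -/
theorem dualMap_bijective {X Y : Type u} [AddCommGroup X] [Module B X] [AddCommGroup Y]
    [Module B Y] (f : X →ₗ[B] Y) (hker : ∀ x, f x = 0 → ∃ s : B, s ≠ 0 ∧ s • x = 0)
    (hsurj : ∀ P : PrimeSpectrum B, P.asIdeal.height ≤ 1 → ∀ y, ∃ t ∉ P.asIdeal, ∃ x, f x = t • y) :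
    Function.Bijective f.dualMap := by
  have hgen : ∀ y, ∃ t : B, t ≠ 0 ∧ ∃ x, f x = t • y := by
    intro y
    -- The zero ideal is one of the primes allowed, so `f` is generically surjective.
    obtain ⟨t, ht, h⟩ := hsurj ⟨⊥, Ideal.isPrime_bot⟩ (by simp) y
    exact ⟨t, fun h0 => ht (by simp [h0]), h⟩
  have hkey : ∀ (k : Dual B X) (x x' : X), f x = f x' → k x = k x' := by
    intro k x x' h
    obtain ⟨s, hs, h0⟩ := hker (x - x') (by rw [map_sub, h, sub_self])
    have h1 := congrArg k h0
    rw [map_smul, map_zero, smul_eq_mul, map_sub] at h1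
    exact sub_eq_zero.1 ((mul_eq_zero.1 h1).resolve_left hs)
  refine ⟨fun h h' hh => LinearMap.ext fun y => ?_, fun k => ?_⟩
  · obtain ⟨t, ht, x, hx⟩ := hgen y
    have h1 := LinearMap.congr_fun hh x
    rw [LinearMap.dualMap_apply, LinearMap.dualMap_apply, hx, map_smul, map_smul] at h1
    exact mul_left_cancel₀ ht h1
  -- The extension of `k` must take the value `k x / t` at `y` whenever `f x = t • y`. It lies in
  -- `B` because at each prime a second presentation `f x' = t' • y` gives `t' * k x = t * k x'`
  -- with `t'` outside the prime.
  · have hex : ∀ y, ∃ z : B, ∀ t x, f x = t • y → k x = t * z := by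
      intro y
      obtain ⟨t, ht, x, hx⟩ := hgen y
      obtain ⟨z, hz⟩ : t ∣ k x := by
        refine dvd_of_forall_height_le_one ht fun P hP => ?_
        obtain ⟨t', ht', x', hx'⟩ := hsurj P hP y
        refine ⟨t', ht', k x', ?_⟩
        have := hkey k (t' • x) (t • x') (by rw [map_smul, map_smul, hx, hx', smul_comm])
        rwa [map_smul, map_smul, smul_eq_mul, smul_eq_mul] at this
      refine ⟨z, fun t' x' hx' => mul_left_cancel₀ ht ?_⟩
      have := hkey k (t' • x) (t • x') (by rw [map_smul, map_smul, hx, hx', smul_comm])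
      rw [map_smul, map_smul, smul_eq_mul, smul_eq_mul, hz] at this
      linear_combination -this
    choose z hz using hex
    have huniq : ∀ y w, (∃ t x, t ≠ 0 ∧ f x = t • y ∧ k x = t * w) → z y = w := by
      rintro y w ⟨t, x, ht, hx, hk⟩
      exact mul_left_cancel₀ ht ((hz y t x hx).symm.trans hk)
    refine ⟨{ toFun := z, map_add' := fun y y' => ?_, map_smul' := fun b y => ?_ },
      LinearMap.ext fun x => ?_⟩
    · obtain ⟨t, ht, x, hx⟩ := hgen y
      obtain ⟨t', ht', x', hx'⟩ := hgen y'
      refine huniq _ _ ⟨t * t', t' • x + t • x', mul_ne_zero ht ht', ?_, ?_⟩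
      · rw [map_add, map_smul, map_smul, hx, hx', smul_add, smul_smul, smul_smul, mul_comm t']
      · rw [map_add, map_smul, map_smul, hz y t x hx, hz y' t' x' hx', smul_eq_mul, smul_eq_mul]
        ring
    · obtain ⟨t, ht, x, hx⟩ := hgen y
      refine huniq _ _ ⟨t, b • x, ht, by rw [map_smul, hx, smul_comm], ?_⟩
      rw [map_smul, hz y t x hx, RingHom.id_apply, smul_eq_mul, smul_eq_mul]
      ring
    · exact huniq _ _ ⟨1, x, one_ne_zero, (one_smul _ _).symm, (one_mul _).symm⟩

end Normal

/-! ### Freeness of rank one at a prime, and base change -/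

section LocallyFree

variable {A : Type u} [CommRing A]

/-- An elementary form of freeness of rank one at `p`: an element `e` and a functional `g` with
`g e ∉ p` such that `(g e) m = (g m) e` at `p` for all `m`. -/
def LocalGenerator (p : Ideal A) (M : Type u) [AddCommGroup M] [Module A M] : Prop :=
  ∃ (e : M) (g : Dual A M), g e ∉ p ∧ ∀ m : M, ∃ t ∉ p, t • (g e • m - g m • e) = 0

variable {p : Ideal A} {M N : Type u} [AddCommGroup M] [Module A M] [AddCommGroup N] [Module A N]

theorem LocalGenerator.genericGenerator (h : LocalGenerator p M) : GenericGenerator A M := by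
  obtain ⟨e, g, hge, hm⟩ := h
  have hp : ∀ {a : A}, a ∉ p → a ≠ 0 := fun ha h0 => ha (h0 ▸ p.zero_mem)
  refine ⟨e, g, hp hge, fun m => ?_⟩
  obtain ⟨t, ht, h⟩ := hm m
  exact ⟨t, hp ht, h⟩

theorem LocalGenerator.tensor [hp : p.IsPrime] (hM : LocalGenerator p M)
    (hN : LocalGenerator p N) : LocalGenerator p (M ⊗[A] N) := by
  obtain ⟨e, g, hge, hm⟩ := hM
  obtain ⟨e', g', hge', hn⟩ := hN
  let G : Dual A (M ⊗[A] N) := TensorProduct.dualDistrib A M N (g ⊗ₜ g')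
  refine ⟨e ⊗ₜ e', G, ?_, fun w => ?_⟩
  · simpa [G] using hp.mul_notMem hge hge'
  induction w using TensorProduct.induction_on with
  | zero => exact ⟨1, hp.one_notMem, by simp⟩
  | add x y hx hy =>
    obtain ⟨s, hs, hs0⟩ := hx
    obtain ⟨t, ht, ht0⟩ := hy
    refine ⟨s * t, hp.mul_notMem hs ht, ?_⟩
    have : G (e ⊗ₜ e') • (x + y) - G (x + y) • (e ⊗ₜ[A] e') =
        (G (e ⊗ₜ e') • x - G x • (e ⊗ₜ[A] e')) + (G (e ⊗ₜ e') • y - G y • (e ⊗ₜ[A] e')) := by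
      rw [map_add, smul_add, add_smul]; abel
    rw [this, smul_add, mul_comm s t, mul_smul, hs0, mul_comm t s, mul_smul, ht0]
    simp
  | tmul m n =>
    obtain ⟨s, hs, hs0⟩ := hm m
    obtain ⟨t, ht, ht0⟩ := hn n
    refine ⟨s * t, hp.mul_notMem hs ht, ?_⟩
    rw [smul_sub, sub_eq_zero] at hs0 ht0
    have h1 : (s • g e • m) ⊗ₜ[A] (t • g' e' • n) = (s • g m • e) ⊗ₜ[A] (t • g' n • e') := by
      rw [hs0, ht0]
    simp only [TensorProduct.smul_tmul_smul] at h1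
    simp only [G, TensorProduct.dualDistrib_apply]
    rw [smul_sub, sub_eq_zero]
    exact h1

variable {B : Type u} [CommRing B] [Algebra A B]

theorem dual_baseChange_tmul (g : Dual A M) (b : B) (m : M) :
    Dual.baseChange B g (b ⊗ₜ m) = b * algebraMap A B (g m) := by
  simp [Algebra.smul_def, mul_comm]

/-- On `b ⊗ m` the relation is `b ⊗ (g e • m - g m • e)`, killed by the image of the multiplier for
`m`; sums use products of multipliers, which avoid the prime `P`. -/
theorem baseChange_generator {P : Ideal B} [hP : P.IsPrime] {e : M} {g : Dual A M}
    (hm : ∀ m : M, ∃ t ∉ P.comap (algebraMap A B), t • (g e • m - g m • e) = 0) (w : B ⊗[A] M) :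
    ∃ t ∉ P, t • (algebraMap A B (g e) • w - Dual.baseChange B g w • (1 ⊗ₜ[A] e)) = 0 := by
  induction w using TensorProduct.induction_on with
  | zero => exact ⟨1, hP.one_notMem, by simp⟩
  | add x y hx hy =>
    obtain ⟨s, hs, hs0⟩ := hx
    obtain ⟨t, ht, ht0⟩ := hy
    refine ⟨s * t, hP.mul_notMem hs ht, ?_⟩
    rw [map_add, smul_add, add_smul, add_sub_add_comm, smul_add, mul_comm s t, mul_smul, hs0,
      mul_comm t s, mul_smul, ht0, smul_zero, smul_zero, add_zero]
  | tmul b m =>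
    obtain ⟨s, hs, hs0⟩ := hm m
    refine ⟨algebraMap A B s, hs, ?_⟩
    have h1 : algebraMap A B (g e) • (b ⊗ₜ[A] m) - Dual.baseChange B g (b ⊗ₜ m) • (1 ⊗ₜ[A] e) =
        b ⊗ₜ[A] (g e • m - g m • e) := by
      rw [dual_baseChange_tmul, algebraMap_smul, TensorProduct.tmul_sub, TensorProduct.tmul_smul,
        TensorProduct.smul_tmul' (b * _), smul_eq_mul, mul_one, ← TensorProduct.smul_tmul,
        Algebra.smul_def (g m), mul_comm b]
    rw [h1, algebraMap_smul, ← TensorProduct.tmul_smul, hs0, TensorProduct.tmul_zero]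

theorem LocalGenerator.baseChange {P : Ideal B} [hP : P.IsPrime]
    (h : LocalGenerator (P.comap (algebraMap A B)) M) : LocalGenerator P (B ⊗[A] M) := by
  obtain ⟨e, g, hge, hm⟩ := h
  have hG : Dual.baseChange B g (1 ⊗ₜ e) = algebraMap A B (g e) := by
    rw [dual_baseChange_tmul, one_mul]
  refine ⟨1 ⊗ₜ e, Dual.baseChange B g, hG ▸ hge, fun w => ?_⟩
  rw [hG]
  exact baseChange_generator hm w

/-- `(B ⊗ M**)** ≅ (B ⊗ M)**` if `M` is free of rank one at the contractions of all primes of `B` of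
height at most one. -/
theorem doubleDual_baseChange_doubleDual [IsDomain A] [IsDomain B] [IsNoetherianRing B]
    [IsIntegrallyClosed B]
    (h : ∀ P : PrimeSpectrum B, P.asIdeal.height ≤ 1 →
      LocalGenerator (P.asIdeal.comap (algebraMap A B)) M) :
    Nonempty (DoubleDual B (B ⊗[A] DoubleDual A M) ≃ₗ[B] DoubleDual B (B ⊗[A] M)) := by
  let f : B ⊗[A] M →ₗ[B] B ⊗[A] DoubleDual A M := (Dual.eval A M).baseChange B
  refine ⟨(LinearEquiv.ofBijective f.dualMap (dualMap_bijective f (fun w hw => ?_)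
    fun P hP w => ?_)).symm.dualMap⟩
  -- The zero ideal of `B` contracts to the kernel of `A → B`, so `g e` is nonzero in `B`. As `g`
  -- extends to `M**`, its base change factors through `f` and vanishes on `ker f`; the generator
  -- relation then makes `ker f` torsion.
  · obtain ⟨e, g, hge, hm⟩ := h ⟨⊥, Ideal.isPrime_bot⟩ (by simp)
    have hfac : ∀ v, Dual.baseChange B g v = Dual.baseChange B (Dual.eval A (Dual A M) g) (f v) := by
      intro v
      induction v using TensorProduct.induction_on with
      | zero => simp
      | add x y hx hy => rw [map_add, hx, hy, map_add, map_add]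
      | tmul b m => simp [f]
    obtain ⟨t, ht, h0⟩ := baseChange_generator hm w
    rw [hfac w, hw, map_zero, zero_smul, sub_zero, smul_smul] at h0
    exact ⟨_, mul_ne_zero ht hge, h0⟩
  · obtain ⟨e, g, hge, hm⟩ := h P hP
    -- Multiplication by `g e`, which is outside the contracted prime, carries all of `M**` into the
    -- image of `M`.
    have hx : ∀ x : DoubleDual A M, g e • x = x g • Dual.eval A M e := by
      intro x
      refine LinearMap.ext fun k => ?_
      have hk : g e • k = k e • g := by
        refine LinearMap.ext fun m => ?_
        obtain ⟨t, ht, h0⟩ := hm m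
        have h1 := congrArg k h0
        rw [map_smul, map_sub, map_smul, map_smul, map_zero, smul_eq_mul] at h1
        have h2 := (mul_eq_zero.1 h1).resolve_left fun ht0 => ht (ht0 ▸ Ideal.zero_mem _)
        simp only [smul_eq_mul, LinearMap.smul_apply] at h2 ⊢
        linear_combination h2
      have h1 := congrArg x hk
      rw [map_smul, map_smul] at h1
      simp only [LinearMap.smul_apply, Dual.eval_apply, smul_eq_mul] at h1 ⊢
      linear_combination h1
    refine ⟨algebraMap A B (g e), hge, ?_⟩
    induction w using TensorProduct.induction_on with
    | zero => exact ⟨0, by simp⟩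
    | add x y hx hy =>
      obtain ⟨v, hv⟩ := hx
      obtain ⟨v', hv'⟩ := hy
      exact ⟨v + v', by rw [map_add, smul_add, hv, hv']⟩
    | tmul b x =>
      refine ⟨b ⊗ₜ (x g • e), ?_⟩
      rw [LinearMap.baseChange_tmul, map_smul, ← hx, algebraMap_smul, TensorProduct.tmul_smul]

end LocallyFree

end DivisorClass

namespace DivisorClass

/-! ### Reflexive modules of rank one over the UFD locus -/

section UFD

/-- A finite family in a unique factorization domain has a greatest common divisor `d`, and every
common divisor of `a • f` divides `a d`. -/
theorem exists_gcd_of_finset {R : Type u} [CommRing R] [IsDomain R] [UniqueFactorizationMonoid R]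
    {ι : Type u} (s : Finset ι) (f : ι → R) :
    ∃ d, (∀ i ∈ s, d ∣ f i) ∧ ∀ a b, (∀ i ∈ s, b ∣ a * f i) → b ∣ a * d := by
  let _ : StrongNormalizationMonoid R := UniqueFactorizationMonoid.strongNormalizationMonoid
  let _ : NormalizedGCDMonoid R := UniqueFactorizationMonoid.toNormalizedGCDMonoid R
  refine ⟨s.gcd f, fun i hi => Finset.gcd_dvd hi, fun a b h => ?_⟩
  exact (Finset.dvd_gcd h).trans (Finset.gcd_mul_left' s f a).dvd

variable {A : Type u} [CommRing A] {M : Type u} [AddCommGroup M] [Module A M]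

/-- A family of divisibilities that hold up to elements outside `p`, uniform over a finitely
generated module. -/
theorem exists_uniform_dvd [Module.Finite A M] (p : Ideal A) [hp : p.IsPrime] (b : A)
    (g : Dual A M) (h : ∀ m, ∃ s ∉ p, b ∣ s * g m) : ∃ s ∉ p, ∀ m, b ∣ s * g m := by
  obtain ⟨S, hS⟩ := (Module.Finite.fg_top : (⊤ : Submodule A M).FG)
  choose s hs hsd using h
  refine ⟨∏ i ∈ S, s i, fun hmem => ?_, fun m => ?_⟩
  · obtain ⟨i, -, hi⟩ := (Ideal.IsPrime.prod_mem_iff).1 hmem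
    exact hs i hi
  · have hmem : m ∈ Submodule.span A (S : Set M) := hS ▸ Submodule.mem_top
    induction hmem using Submodule.span_induction with
    | mem x hx =>
      exact (hsd x).trans (mul_dvd_mul_right (Finset.dvd_prod_of_mem s hx) _)
    | zero => simp
    | add x y _ _ hx hy => rw [map_add, mul_add]; exact dvd_add hx hy
    | smul a x _ hx => rw [map_smul, smul_eq_mul, mul_left_comm]; exact hx.mul_left a

variable [IsDomain A]

theorem exists_dvd_mul_of_dvd_algebraMap (p : Ideal A) [hp : p.IsPrime] {a b : A}
    (h : algebraMap A (Localization.AtPrime p) b ∣ algebraMap A (Localization.AtPrime p) a) :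
    ∃ s ∉ p, b ∣ s * a := by
  obtain ⟨c, hc⟩ := h
  obtain ⟨⟨r, s⟩, hrs⟩ := IsLocalization.surj p.primeCompl c
  refine ⟨s, s.2, r, IsLocalization.injective (Localization.AtPrime p)
    p.primeCompl_le_nonZeroDivisors ?_⟩
  rw [map_mul, map_mul, hc, ← hrs]
  ring

/-- Exact division of a functional by a nonzero scalar. -/
theorem exists_smul_eq_of_dvd {b : A} (hb : b ≠ 0) (g : Dual A M) (h : ∀ m, b ∣ g m) :
    ∃ g' : Dual A M, b • g' = g := by
  choose g' hg' using h
  refine ⟨{ toFun := g', map_add' := fun x y => ?_, map_smul' := fun a x => ?_ }, ?_⟩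
  · apply mul_left_cancel₀ hb
    rw [mul_add, ← hg', ← hg', ← hg', map_add]
  · apply mul_left_cancel₀ hb
    rw [← hg', map_smul, hg', RingHom.id_apply, smul_eq_mul, smul_eq_mul, mul_left_comm]
  · exact LinearMap.ext fun m => (hg' m).symm

/-- A rank-one reflexive module over a Noetherian domain is free at the primes of the UFD locus. -/
theorem localGenerator_of_mem_UFDLocus [IsNoetherianRing A] [hM : IsRankOneReflexive A M]
    {p : PrimeSpectrum A} (hp : p ∈ UFDLocus A) : LocalGenerator p.asIdeal M := by
  have := hM.finite
  have := hM.reflexive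
  have hinj : Function.Injective (Dual.eval A M) := (Module.bijective_dual_eval A M).1
  obtain ⟨e, g, hge, hk⟩ :=
    (genericGenerator_of_isRankOneReflexive hM).exists_functional
  -- All functionals are generically proportional and `M` embeds in `M**`, so the generator relation
  -- will hold exactly, with multiplier `1`.
  have hdual : ∀ (k : Dual A M) (m m' : M), k m • m' = k m' • m := by
    intro k m m'
    refine hinj (LinearMap.ext fun l => mul_left_cancel₀ (mul_ne_zero hge hge) ?_)
    have h1 := fun x => LinearMap.congr_fun (hk k) x
    have h2 := fun x => LinearMap.congr_fun (hk l) x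
    simp only [LinearMap.smul_apply, smul_eq_mul] at h1 h2
    simp only [map_smul, LinearMap.smul_apply, Dual.eval_apply, smul_eq_mul]
    calc g e * g e * (k m * l m') = (g e * k m) * (g e * l m') := by ring
      _ = (g e * k m') * (g e * l m) := by rw [h1, h2, h1, h2]; ring
      _ = _ := by ring
  let R := Localization.AtPrime p.asIdeal
  have hR : UniqueFactorizationMonoid R := hp
  obtain ⟨S, hS⟩ := (Module.Finite.fg_top : (⊤ : Submodule A M).FG)
  -- `g` identifies `M` with an ideal; locally, dividing by the gcd `d` of its generators should
  -- give the unit ideal. The functional is thus `g / d`, and the generator is `(d / g e) • e`, each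
  -- up to a factor outside `p`.
  obtain ⟨d₀, hd₀, hd₀'⟩ := exists_gcd_of_finset S fun m => algebraMap A R (g m)
  obtain ⟨⟨d, c⟩, hdc⟩ := IsLocalization.surj p.asIdeal.primeCompl d₀
  have hassoc : Associated d₀ (algebraMap A R d) :=
    ⟨(IsLocalization.map_units R c).unit, hdc⟩
  have hdvd : ∀ m, algebraMap A R d ∣ algebraMap A R (g m) := by
    intro m
    have hmem : m ∈ Submodule.span A (S : Set M) := hS ▸ Submodule.mem_top
    induction hmem using Submodule.span_induction with
    | mem x hx => exact hassoc.symm.dvd.trans (hd₀ x hx)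
    | zero => simp
    | add x y _ _ hx hy => rw [map_add, map_add]; exact dvd_add hx hy
    | smul a x _ hx => rw [map_smul, smul_eq_mul, map_mul]; exact hx.mul_left _
  have hd : d ≠ 0 := by
    rintro rfl
    have h0 := hdvd e
    rw [map_zero, zero_dvd_iff] at h0
    exact hge (IsLocalization.injective R p.asIdeal.primeCompl_le_nonZeroDivisors
      (h0.trans (map_zero _).symm))
  obtain ⟨s, hs, hsd⟩ := exists_uniform_dvd p.asIdeal d g
    fun m => exists_dvd_mul_of_dvd_algebraMap p.asIdeal (hdvd m)
  obtain ⟨g', hg'⟩ := exists_smul_eq_of_dvd hd (s • g) hsd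
  -- `g e` divides `k e * g m` for all `m`, hence locally `k e * d` by the gcd property. So `(d / g
  -- e) • e` is, up to `s'`, an element of `M**`, and reflexivity brings it back to `M`.
  obtain ⟨s', hs', hsd'⟩ := exists_uniform_dvd p.asIdeal (g e) (d • Dual.eval A M e) fun k => by
    refine exists_dvd_mul_of_dvd_algebraMap p.asIdeal ?_
    have h1 := hd₀' (algebraMap A R (k e)) (algebraMap A R (g e)) fun m _ => by
      rw [← map_mul]
      exact map_dvd _ ⟨k m, (LinearMap.congr_fun (hk k) m).symm⟩
    refine h1.trans ?_
    rw [LinearMap.smul_apply, Dual.eval_apply, smul_eq_mul, map_mul, mul_comm]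
    exact mul_dvd_mul_right hassoc.dvd _
  obtain ⟨x, hx⟩ := exists_smul_eq_of_dvd hge (s' • d • Dual.eval A M e) hsd'
  obtain ⟨m₀, rfl⟩ := (Module.bijective_dual_eval A M).2 x
  have hval : g' m₀ = s' * s := by
    apply mul_left_cancel₀ hge
    have h1 := LinearMap.congr_fun hx g'
    have h2 := LinearMap.congr_fun hg' e
    simp only [LinearMap.smul_apply, Dual.eval_apply, smul_eq_mul] at h1 h2
    rw [h1, h2]
    ring
  refine ⟨m₀, g', hval ▸ p.isPrime.mul_notMem hs' hs, fun m => ⟨1, p.isPrime.one_notMem, ?_⟩⟩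
  rw [hdual, sub_self, smul_zero]

end UFD

end DivisorClass

/-! ### The induced homomorphisms and their composition -/

namespace DivisorClassGroup

open DivisorClass

variable {A B : Type u} [CommRing A] [IsDomain A] [IsNoetherianRing A] [CommRing B]

theorem localGenerator_comap [Algebra A B] (h : ContractsToUFDLocus (algebraMap A B))
    (M : Type u) [AddCommGroup M] [Module A M] [IsRankOneReflexive A M]
    (P : PrimeSpectrum B) (hP : P.asIdeal.height ≤ 1) :
    LocalGenerator (P.asIdeal.comap (algebraMap A B)) M :=
  localGenerator_of_mem_UFDLocus (h P hP)

variable [IsDomain B]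

/-- `A → B` need not be injective, so the generic rank of `M` does not suffice: (†) at the zero
ideal of `B` gives freeness at the kernel. -/
theorem genericGenerator_baseChange [Algebra A B] (h : ContractsToUFDLocus (algebraMap A B))
    (M : Type u) [AddCommGroup M] [Module A M] [IsRankOneReflexive A M] :
    GenericGenerator B (B ⊗[A] M) :=
  (localGenerator_comap h M ⟨⊥, Ideal.isPrime_bot⟩ (by simp)).baseChange.genericGenerator

variable [IsNoetherianRing B]

theorem isRankOneReflexive_baseChange [Algebra A B] (h : ContractsToUFDLocus (algebraMap A B))
    (M : Type u) [AddCommGroup M] [Module A M] [hM : IsRankOneReflexive A M] :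
    IsRankOneReflexive B (DoubleDual B (B ⊗[A] M)) :=
  haveI := hM.finite
  isRankOneReflexive_dual (genericGenerator_baseChange h M).dual

variable [IsIntegrallyClosed A] [IsIntegrallyClosed B]

/-- The map `[M] ↦ [(B ⊗ M)**]` on divisor classes. -/
def baseChangeHom [Algebra A B] (h : ContractsToUFDLocus (algebraMap A B)) :
    DivisorClassGroup A →* DivisorClassGroup B :=
  MonoidHom.mk'
    (Quotient.map
      (fun M => @RankOneReflexive.mk B _ _ (DoubleDual B (B ⊗[A] M.carrier)) _ _
        (isRankOneReflexive_baseChange h M.carrier))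
      fun _ _ ⟨e⟩ => doubleDual_congr (e.baseChange A B _ _))
    fun x y => by
      induction x using ind with | _ M
      induction y using ind with | _ N
      have hM := isRankOneReflexive_baseChange h M
      have hN := isRankOneReflexive_baseChange h N
      have hMN := isRankOneReflexive_baseChange h (DoubleDual A (M ⊗[A] N))
      change cl B (DoubleDual B (B ⊗[A] DoubleDual A (M ⊗[A] N))) =
        cl B (DoubleDual B (B ⊗[A] M)) * cl B (DoubleDual B (B ⊗[A] N))
      rw [cl_mul_cl, cl_eq_cl]
      -- Removing the inner double dual is where (†) enters. The two commutations below serve to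
      -- reflexivize both factors, as `doubleDual_tensor_doubleDual` only treats the left one.
      obtain ⟨e₁⟩ := doubleDual_baseChange_doubleDual (B := B) (M := M ⊗[A] N) fun P hP =>
        haveI := P.isPrime
        (localGenerator_comap h M P hP).tensor (localGenerator_comap h N P hP)
      obtain ⟨e₂⟩ := doubleDual_congr (A := B) (M := B ⊗[A] (M ⊗[A] N))
        (N := (B ⊗[A] N) ⊗[B] (B ⊗[A] M)) (AlgebraTensorModule.distribBaseChange A B M N ≪≫ₗ
          TensorProduct.comm B (B ⊗[A] M) (B ⊗[A] N))
      obtain ⟨e₃⟩ := doubleDual_tensor_doubleDual (N := B ⊗[A] M)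
        (genericGenerator_baseChange h N)
      obtain ⟨e₄⟩ := doubleDual_congr (A := B)
        (M := DoubleDual B (B ⊗[A] N) ⊗[B] (B ⊗[A] M))
        (N := (B ⊗[A] M) ⊗[B] DoubleDual B (B ⊗[A] N))
        (TensorProduct.comm B (DoubleDual B (B ⊗[A] N)) (B ⊗[A] M))
      obtain ⟨e₅⟩ := doubleDual_tensor_doubleDual (N := DoubleDual B (B ⊗[A] N))
        (genericGenerator_baseChange h M)
      exact ⟨e₁ ≪≫ₗ e₂ ≪≫ₗ e₃.symm ≪≫ₗ e₄ ≪≫ₗ e₅.symm⟩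

theorem baseChangeHom_cl [Algebra A B] (h : ContractsToUFDLocus (algebraMap A B))
    (M : Type u) [AddCommGroup M] [Module A M] [IsRankOneReflexive A M]
    [IsRankOneReflexive B (DoubleDual B (B ⊗[A] M))] :
    baseChangeHom h (cl A M) = cl B (DoubleDual B (B ⊗[A] M)) := rfl

theorem baseChangeHom_comp {C : Type u} [CommRing C] [IsDomain C] [IsNoetherianRing C]
    [IsIntegrallyClosed C] [Algebra A B] [Algebra B C] [Algebra A C] [IsScalarTower A B C]
    (hAB : ContractsToUFDLocus (algebraMap A B)) (hBC : ContractsToUFDLocus (algebraMap B C))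
    (hAC : ContractsToUFDLocus (algebraMap A C)) :
    baseChangeHom hAC = (baseChangeHom hBC).comp (baseChangeHom hAB) := by
  ext x
  induction x using ind with | _ M
  have := isRankOneReflexive_baseChange hAB M
  have := isRankOneReflexive_baseChange hAC M
  have := isRankOneReflexive_baseChange hBC (DoubleDual B (B ⊗[A] M))
  rw [MonoidHom.comp_apply, baseChangeHom_cl, baseChangeHom_cl, baseChangeHom_cl, cl_eq_cl]
  -- The contraction of `P` to `B` may have height above one, so freeness of `B ⊗ M` there comes
  -- from (†) for `A → C`, not for `A → B`.
  obtain ⟨e₁⟩ := doubleDual_baseChange_doubleDual (B := C) (M := B ⊗[A] M) fun P hP => by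
    have hP' := localGenerator_comap hAC M P hP
    rw [IsScalarTower.algebraMap_eq A B C, ← Ideal.comap_comap] at hP'
    have := P.isPrime
    exact hP'.baseChange
  obtain ⟨e₂⟩ := doubleDual_congr (AlgebraTensorModule.cancelBaseChange A B C C M)
  exact ⟨e₂.symm ≪≫ₗ e₁.symm⟩

end DivisorClassGroup

theorem mainTheorem4 {A B C : Type u}
    [CommRing A] [IsDomain A] [IsNoetherianRing A] [IsIntegrallyClosed A]
    [CommRing B] [IsDomain B] [IsNoetherianRing B] [IsIntegrallyClosed B]
    [CommRing C] [IsDomain C] [IsNoetherianRing C] [IsIntegrallyClosed C]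
    (φ : A →+* B) (ψ : B →+* C)
    (hφ : ContractsToUFDLocus φ) (hψ : ContractsToUFDLocus ψ)
    (hψφ : ContractsToUFDLocus (ψ.comp φ)) :
    ∃ (Clφ : DivisorClassGroup A →* DivisorClassGroup B)
      (Clψ : DivisorClassGroup B →* DivisorClassGroup C)
      (Clψφ : DivisorClassGroup A →* DivisorClassGroup C),
      IsInducedClassMap φ Clφ ∧ IsInducedClassMap ψ Clψ ∧ IsInducedClassMap (ψ.comp φ) Clψφ ∧
        Clψφ = Clψ.comp Clφ := by
  let _ : Algebra A B := φ.toAlgebra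
  let _ : Algebra B C := ψ.toAlgebra
  let _ : Algebra A C := (ψ.comp φ).toAlgebra
  have : IsScalarTower A B C := .of_algebraMap_eq fun _ => rfl
  exact ⟨DivisorClassGroup.baseChangeHom hφ, DivisorClassGroup.baseChangeHom hψ,
    DivisorClassGroup.baseChangeHom hψφ,
    fun M _ _ _ => ⟨DivisorClassGroup.isRankOneReflexive_baseChange hφ M, rfl⟩,
    fun M _ _ _ => ⟨DivisorClassGroup.isRankOneReflexive_baseChange hψ M, rfl⟩,
    fun M _ _ _ => ⟨DivisorClassGroup.isRankOneReflexive_baseChange hψφ M, rfl⟩,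
    DivisorClassGroup.baseChangeHom_comp hφ hψ hψφ⟩
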